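/- An elliptic curve over $\mathbb C$ is given by a nonsingular Weierstrass equation, with point at infinity $O$ as the identity. Meromorphic functions are viewed as regular maps to $\mathbb P^1(\mathbb C)=\mathbb C\cup\{\infty\}$ that are not identically $\infty$. A toroidal Belyĭ pair $(E,\beta)$ consists of an elliptic curve $E$ over $\mathbb C$ and a non-constant meromorphic function $\beta$ on $E(\mathbb C)$ such that $\beta(P)\in\{0,1,\infty\}$ for every point $P$ with ramification index $e_\beta(P)\ge 2$; its set of quasi-critical points is $\Gamma=\beta^{-1}(\{0,1,\infty\})\subseteq E(\mathbb C)$. An isogeny is a morphism of curves that is a group homomorphism (possibly constant). A dynamical Belyĭ map $\gamma:\mathbb P^1(\mathbb C)\to\mathbb P^1(\mathbb C)$ is a non-constant rational map with critical values in $\{0,1,\infty\}$ and $\gamma(\{0,1,\infty\})\subseteq\{0,1,\infty\}$. The pair $(E,\beta)$ is imprimitive if $\beta=\gamma\circ\phi\circ\psi$ for some isogeny $\psi:E\to X$ of elliptic curves, meromorphic function $\phi$ on $X(\mathbb C)$ and dynamical Belyĭ map $\gamma$, where $\psi$ and $\gamma$ are not both isomorphisms. Two pairs $(E,\beta)$,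 $(E',\beta')$ are isomorphic if $\beta=\beta'\circ\sigma$ for an isomorphism of curves $\sigma:E\to E'$ (not necessarily with $\sigma(O)=O$). **Corollary.** Let $X: y^2=x^3+1$ and $\phi=(1-y)/2$. 1. $(X,\phi)$ is a toroidal Belyĭ pair, and its set of quasi-critical points is $\{O,(0,1),(0,-1)\}$, a subgroup of $X(\mathbb C)$ isomorphic to $\mathbb Z/3\mathbb Z$. 2. For every elliptic curve $E$ over $\mathbb C$ and every non-constant isogeny $\psi:E\to X$, $(E,\phi\circ\psi)$ is a toroidal Belyĭ pair whose quasi-critical points form a subgroup of $E(\mathbb C)$; it is imprimitive if $\psi$ is not an isomorphism. 3. There are infinitely many pairwise non-isomorphic imprimitive toroidal Belyĭ pairs of the form $(E,\phi\circ\psi)$ with $\psi:E\to X$ a non-constant isogeny; in particular, there are infinitely many pairwise non-isomorphic imprimitive toroidal Belyĭ pairs whose quasi-critical points form a group. -/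

import Mathlib

open scoped OnePoint

noncomputable section

namespace ToroidalBelyi

/-! ### Projective curves, regular maps, ramification -/

/-- A set of points of a complex projective space, given by homogeneous coordinates. It is used
only for the Riemann sphere and for the complex points of elliptic curves, see the two instances. -/
class ProjectiveModel (S : Type) where
  dim : ℕ
  coord : S → Fin (dim + 1) → ℂ
  coord_ne_zero : ∀ P, coord P ≠ 0
  coord_injective : ∀ P Q (c : ℂ), coord P = c • coord Q → P = Q

/-- Homogeneous coordinates `[z : 1]` and `∞ = [1 : 0]` on the Riemann sphere `ℂ ∪ {∞}`. -/
def sphereCoord : OnePoint ℂ → Fin 2 → ℂ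
  | ∞ => ![1, 0]
  | OnePoint.some z => ![z, 1]

instance sphereModel : ProjectiveModel (OnePoint ℂ) where
  dim := 1
  coord := sphereCoord
  coord_ne_zero P h := by
    induction P with
    | infty => simpa [sphereCoord] using congrFun h 0
    | coe z => simpa [sphereCoord] using congrFun h 1
  coord_injective P Q c h := by
    have h0 := congrFun h 0
    have h1 := congrFun h 1
    induction P with
    | infty =>
      induction Q with
      | infty => rfl
      | coe w =>
        simp [sphereCoord] at h0 h1
        simp [← h1] at h0
    | coe z =>
      induction Q with
      | infty => simp [sphereCoord] at h1
      | coe w =>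
        simp [sphereCoord] at h0 h1
        simp [h0, ← h1]

/-- Homogeneous coordinates `[x : y : 1]` and `O = [0 : 1 : 0]` on a Weierstrass curve. -/
def pointCoord (E : WeierstrassCurve ℂ) : E.toAffine.Point → Fin 3 → ℂ
  | .zero => ![0, 1, 0]
  | .some x y _ => ![x, y, 1]

instance curveModel (E : WeierstrassCurve ℂ) : ProjectiveModel E.toAffine.Point where
  dim := 2
  coord := pointCoord E
  coord_ne_zero P h := by
    cases P with
    | zero => simpa [pointCoord] using congrFun h 1
    | some x y hxy => simpa [pointCoord] using congrFun h 2
  coord_injective P Q c h := by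
    have h0 := congrFun h 0
    have h1 := congrFun h 1
    have h2 := congrFun h 2
    cases P with
    | zero =>
      cases Q with
      | zero => rfl
      | some x y hxy =>
        simp [pointCoord] at h1 h2
        simp [← h2] at h1
    | some x y hxy =>
      cases Q with
      | zero => simp [pointCoord] at h2
      | some x' y' hxy' =>
        simp [pointCoord] at h0 h1 h2
        simp [h0, h1, ← h2]

section General

variable {S T : Type} [ProjectiveModel S] [ProjectiveModel T]

/-- The value of a polynomial in the homogeneous coordinates of a point. -/
def value (F : MvPolynomial (Fin (ProjectiveModel.dim S + 1)) ℂ) (P : S) : ℂ :=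
  MvPolynomial.eval (ProjectiveModel.coord P) F

/-- `f` is a morphism (regular map): around every point `P` it is given by homogeneous polynomials
of one common degree that have no common zero at `P`. (They give `f` at all the points that are not
common zeros of them; the factor `c` is then nonzero.) -/
def IsRegularMap (f : S → T) : Prop :=
  ∀ P : S, ∃ (n : ℕ) (F : Fin (ProjectiveModel.dim T + 1) →
      MvPolynomial (Fin (ProjectiveModel.dim S + 1)) ℂ),
    (∀ k, (F k).IsHomogeneous n) ∧ (∃ k, value (F k) P ≠ 0) ∧
      ∀ Q : S, (∃ k, value (F k) Q ≠ 0) →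
        ∃ c : ℂ, (fun k => value (F k) Q) = c • ProjectiveModel.coord (f Q)

/-- An isomorphism of curves: a regular map with a regular inverse. -/
def IsIsomorphism (f : S → T) : Prop :=
  IsRegularMap f ∧ ∃ g : T → S, IsRegularMap g ∧ Function.LeftInverse g f ∧
    Function.RightInverse g f

def IsConstant {A B : Type} (f : A → B) : Prop := ∃ b, ∀ a, f a = b

/-- A meromorphic function is a regular map to the Riemann sphere that is not identically `∞`. -/
def IsMeromorphic (β : S → OnePoint ℂ) : Prop :=
  IsRegularMap β ∧ ∃ P, β P ≠ ∞

/-- `h` is regular at `P`: on a Zariski neighbourhood of `P` it equals a quotient `F / G` of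
homogeneous polynomials of the same degree, with `G ≠ 0` there. -/
def IsRegularAt (P : S) (h : S → ℂ) : Prop :=
  ∃ (n : ℕ) (F G : MvPolynomial (Fin (ProjectiveModel.dim S + 1)) ℂ),
    F.IsHomogeneous n ∧ G.IsHomogeneous n ∧ value G P ≠ 0 ∧
      ∀ Q : S, value G Q ≠ 0 → h Q = value F Q / value G Q

/-- The ring `𝒪_P` of the functions that are regular at `P`. (Functions that agree near `P` are not
identified here; their difference lies in every power of the ideal `M_P` below, so the
powers of `M_P` are the preimages of those of the maximal ideal of the local ring of the curve.) -/
def localRing (P : S) : Subring (S → ℂ) where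
  carrier := {h | IsRegularAt P h}
  zero_mem' := ⟨0, 0, 1, MvPolynomial.isHomogeneous_zero _ _ _, MvPolynomial.isHomogeneous_one _ _,
    by simp [value], fun Q _ => by simp [value]⟩
  one_mem' := ⟨0, 1, 1, MvPolynomial.isHomogeneous_one _ _, MvPolynomial.isHomogeneous_one _ _,
    by simp [value], fun Q _ => by simp [value]⟩
  neg_mem' := by
    rintro h ⟨n, F, G, hF, hG, hP, hh⟩
    refine ⟨n, -F, G, hF.neg, hG, hP, fun Q hQ => ?_⟩
    simp [value, neg_div, hh Q hQ]
  add_mem' := by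
    rintro h₁ h₂ ⟨n₁, F₁, G₁, hF₁, hG₁, hP₁, hh₁⟩ ⟨n₂, F₂, G₂, hF₂, hG₂, hP₂, hh₂⟩
    refine ⟨n₁ + n₂, F₁ * G₂ + G₁ * F₂, G₁ * G₂, (hF₁.mul hG₂).add (hG₁.mul hF₂), hG₁.mul hG₂,
      ?_, fun Q hQ => ?_⟩
    · simpa [value] using And.intro hP₁ hP₂
    · have hQ' : value G₁ Q ≠ 0 ∧ value G₂ Q ≠ 0 := by simpa [value] using hQ
      rw [Pi.add_apply, hh₁ Q hQ'.1, hh₂ Q hQ'.2, div_add_div _ _ hQ'.1 hQ'.2]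
      simp [value]
  mul_mem' := by
    rintro h₁ h₂ ⟨n₁, F₁, G₁, hF₁, hG₁, hP₁, hh₁⟩ ⟨n₂, F₂, G₂, hF₂, hG₂, hP₂, hh₂⟩
    refine ⟨n₁ + n₂, F₁ * F₂, G₁ * G₂, hF₁.mul hF₂, hG₁.mul hG₂, ?_, fun Q hQ => ?_⟩
    · simpa [value] using And.intro hP₁ hP₂
    · have hQ' : value G₁ Q ≠ 0 ∧ value G₂ Q ≠ 0 := by simpa [value] using hQ
      rw [Pi.mul_apply, hh₁ Q hQ'.1, hh₂ Q hQ'.2, div_mul_div_comm]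
      simp [value]

/-- The ideal `M_P` of `𝒪_P` of the functions that vanish at `P`. -/
def vanishingIdeal (P : S) : Ideal (localRing P) :=
  RingHom.ker ((Pi.evalRingHom (fun _ : S => ℂ) P).comp (localRing P).subtype)

/-- The standard local parameter of the Riemann sphere at `q`: `z - q` for finite `q`, and `1 / z`
for `q = ∞` (with the irrelevant value `0` at the pole of this parameter). -/
def localParameter : OnePoint ℂ → OnePoint ℂ → ℂ
  | ∞, ∞ => 0
  | ∞, OnePoint.some z => z⁻¹
  | OnePoint.some _, ∞ => 0
  | OnePoint.some q, OnePoint.some z => z - q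

/-- `e_β(P)`: the largest `e` such that `β - β(P)` (or `1 / β`, if `β(P) = ∞`) lies in the `e`-th
power of `M_P`. -/
def ramificationIndex (β : S → OnePoint ℂ) (P : S) : ℕ∞ :=
  ⨆ e : {e : ℕ // ∃ h ∈ vanishingIdeal P ^ e,
    (h : S → ℂ) = fun Q => localParameter (β P) (β Q)}, (e.1 : ℕ∞)

def IsCriticalPoint (β : S → OnePoint ℂ) (P : S) : Prop := 2 ≤ ramificationIndex β P

/-- The subset `{0, 1, ∞}` of the Riemann sphere. -/
def specialValues : Set (OnePoint ℂ) := {((0 : ℂ) : OnePoint ℂ), ((1 : ℂ) : OnePoint ℂ), ∞}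

/-- A Belyi map: a non-constant meromorphic function with critical values in `{0, 1, ∞}`. -/
def IsBelyiMap (β : S → OnePoint ℂ) : Prop :=
  IsMeromorphic β ∧ ¬ IsConstant β ∧ ∀ P, IsCriticalPoint β P → β P ∈ specialValues

/-- The set `Γ = β⁻¹({0, 1, ∞})`. -/
def quasiCriticalPoints (β : S → OnePoint ℂ) : Set S := β ⁻¹' specialValues

end General

/-- A dynamical Belyi map of the Riemann sphere. -/
def IsDynamicalBelyiMap (γ : OnePoint ℂ → OnePoint ℂ) : Prop :=
  IsBelyiMap γ ∧ Set.MapsTo γ specialValues specialValues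

/-! ### Elliptic curves -/

/-- An isogeny: a morphism that is a group homomorphism (possibly the constant one). -/
def IsIsogeny {E X : WeierstrassCurve ℂ} (ψ : E.toAffine.Point → X.toAffine.Point) : Prop :=
  IsRegularMap ψ ∧ ∀ P Q, ψ (P + Q) = ψ P + ψ Q

/-- A toroidal Belyi pair: an elliptic curve over `ℂ` with a Belyi map on it. -/
structure ToroidalBelyiPair where
  curve : WeierstrassCurve ℂ
  isElliptic : curve.IsElliptic
  map : curve.toAffine.Point → OnePoint ℂ
  isBelyiMap : IsBelyiMap map

/-- Two pairs are isomorphic if some isomorphism of curves (not necessarily fixing the origin)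
carries one map to the other. -/
def ToroidalBelyiPair.Isomorphic (p q : ToroidalBelyiPair) : Prop :=
  ∃ σ : p.curve.toAffine.Point → q.curve.toAffine.Point, IsIsomorphism σ ∧ p.map = q.map ∘ σ

/-- The map of the pair is a composition `γ ∘ φ ∘ ψ` of an isogeny, a meromorphic function on an
elliptic curve and a dynamical Belyi map that is nontrivial: `ψ` and `γ` are not both
isomorphisms. -/
def ToroidalBelyiPair.IsImprimitive (p : ToroidalBelyiPair) : Prop :=
  ∃ (X : WeierstrassCurve ℂ) (ψ : p.curve.toAffine.Point → X.toAffine.Point)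
    (φ : X.toAffine.Point → OnePoint ℂ) (γ : OnePoint ℂ → OnePoint ℂ),
    X.IsElliptic ∧ IsIsogeny ψ ∧ IsMeromorphic φ ∧ IsDynamicalBelyiMap γ ∧
      p.map = γ ∘ φ ∘ ψ ∧ ¬ (IsIsomorphism ψ ∧ IsIsomorphism γ)

/-- The quasi-critical points form a subgroup of the group of points. -/
def ToroidalBelyiPair.QuasiCriticalPointsFormGroup (p : ToroidalBelyiPair) : Prop :=
  ∃ H : AddSubgroup p.curve.toAffine.Point, (H : Set p.curve.toAffine.Point) =
    quasiCriticalPoints p.map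

/-! ### The curve `y² = x³ + 1` with the function `(1 - y) / 2` -/

/-- The curve `y² = x³ + 1`. -/
def curveX : WeierstrassCurve ℂ := ⟨0, 0, 0, 0, 1⟩

/-- The function `(1 - y) / 2` on `y² = x³ + 1`, with its pole at the point at infinity. -/
def phiX : curveX.toAffine.Point → OnePoint ℂ
  | .zero => ∞
  | .some _ y _ => (((1 - y) / 2 : ℂ) : OnePoint ℂ)

end ToroidalBelyi

end

/-!
The pairs of the theorem are compositions `φ ∘ ψ` with `φ = (1 - y) / 2` on `y² = x³ + 1`, and the
point of the proof is that an isogeny `ψ` in characteristic zero is unramified, so that `φ ∘ ψ` has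
no critical values besides those of `φ`.

Ramification is tested along differentiable curves `c : ℂ → E(ℂ)`, that is, maps whose homogeneous
coordinates are differentiable at a point. An element of `M_P ^ 2` has derivative zero along every
such curve through `P` (`hasDerivAt_zero_of_mem_sq`). Let `P` be a critical point of `φ ∘ ψ` with
`φ (ψ P) ∉ {0, 1, ∞}`. Then `y ∘ ψ` has derivative zero along the curves through `P`, and the
equation `y² = x³ + 1` forces the same for `x ∘ ψ`, because `x (ψ P) ≠ 0`
(`hasDerivAt_zero_of_isCriticalPoint`). Since `ψ` is a homomorphism and translations are
differentiable (`exists_tangentMap_add`), the tangent map of `ψ` vanishes at the other affine points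
with affine image too. Hence `ψ` is constant on a disc in the parametrization of `E` by `x`, and its
kernel is infinite. A polynomial with infinitely many zeros on the affine curve vanishes on it, by
taking norms from the coordinate ring to `ℂ[x]`, so `ψ` is constant
(`IsIsogeny.eq_zero_of_hasDerivAt_zero`).

The quasi-critical points of `φ` are the multiples of the 3-torsion point `(0, 1)`, and those of
`φ ∘ ψ` form the preimage of this subgroup. Imprimitivity is witnessed by `γ = id`. The infinite
family consists of `φ ∘ [2 ^ k]` on `y² = x³ + 1`: the number of poles is the order of the kernel of
`[2 ^ k]`, which is finite and strictly increasing in `k`, and an isomorphism of pairs preserves it.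
-/

noncomputable section

namespace ToroidalBelyi

/-! ### Composition of regular maps -/

section General

variable {S T U : Type} [ProjectiveModel S] [ProjectiveModel T] [ProjectiveModel U]

theorem eval_smul_of_isHomogeneous {σ : Type*} {F : MvPolynomial σ ℂ} {n : ℕ}
    (hF : F.IsHomogeneous n) (c : ℂ) (v : σ → ℂ) :
    MvPolynomial.eval (c • v) F = c ^ n * MvPolynomial.eval v F := by
  rw [MvPolynomial.eval_eq, MvPolynomial.eval_eq, Finset.mul_sum]
  refine Finset.sum_congr rfl fun d hd => ?_
  have hdeg : ∑ i ∈ d.support, d i = n := by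
    have := hF (MvPolynomial.mem_support_iff.mp hd)
    rwa [Finsupp.weight_apply, Finsupp.sum,
      Finset.sum_congr rfl (fun i _ => by rw [Pi.one_apply, smul_eq_mul, mul_one])] at this
  simp only [Pi.smul_apply, smul_eq_mul, mul_pow, Finset.prod_mul_distrib,
    Finset.prod_pow_eq_pow_sum, hdeg]
  ring

theorem IsRegularMap.of_forall (f : S → T) (n : ℕ)
    (F : Fin (ProjectiveModel.dim T + 1) → MvPolynomial (Fin (ProjectiveModel.dim S + 1)) ℂ)
    (hF : ∀ k, (F k).IsHomogeneous n) (h0 : ∀ P : S, ∃ k, value (F k) P ≠ 0)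
    (h : ∀ P : S, ∃ c : ℂ, (fun k => value (F k) P) = c • ProjectiveModel.coord (f P)) :
    IsRegularMap f :=
  fun P => ⟨n, F, hF, h0 P, fun Q _ => h Q⟩

theorem isRegularMap_id : IsRegularMap (id : S → S) :=
  .of_forall _ 1 MvPolynomial.X (fun k => MvPolynomial.isHomogeneous_X _ k)
    (fun P => by
      by_contra! h
      exact ProjectiveModel.coord_ne_zero P (funext fun k => by simpa [value] using h k))
    (fun P => ⟨1, by ext; simp [value]⟩)

theorem IsRegularMap.comp {g : T → U} {f : S → T} (hg : IsRegularMap g) (hf : IsRegularMap f) :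
    IsRegularMap (g ∘ f) := by
  intro P
  obtain ⟨m, F, hF, ⟨i, hi⟩, hFf⟩ := hf P
  obtain ⟨n, G, hG, ⟨j, hj⟩, hGg⟩ := hg (f P)
  have key : ∀ Q, ∃ c : ℂ, (fun k => value (F k) Q) = c • ProjectiveModel.coord (f Q) := by
    intro Q
    by_cases h : ∃ k, value (F k) Q ≠ 0
    · exact hFf Q h
    · push Not at h
      exact ⟨0, by ext k; simp [h k]⟩
  have val : ∀ Q k c, (fun k => value (F k) Q) = c • ProjectiveModel.coord (f Q) →
      value (MvPolynomial.bind₁ F (G k)) Q = c ^ n * value (G k) (f Q) := by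
    intro Q k c hc
    rw [value, value, ← eval_smul_of_isHomogeneous (hG k), ← hc]
    exact MvPolynomial.eval₂Hom_bind₁ _ _ _ _
  refine ⟨m * n, fun k => MvPolynomial.bind₁ F (G k), fun k => ?_, ⟨j, ?_⟩, fun Q ⟨k, hk⟩ => ?_⟩
  · exact (hG k).aeval F hF
  · obtain ⟨c, hc⟩ := key P
    rw [val P j c hc]
    refine mul_ne_zero (pow_ne_zero _ ?_) hj
    rintro rfl
    exact hi (by simpa using congrFun hc i)
  · obtain ⟨c, hc⟩ := key Q
    rw [val Q k c hc] at hk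
    obtain ⟨d, hd⟩ := hGg (f Q) ⟨k, right_ne_zero_of_mul hk⟩
    refine ⟨c ^ n * d, funext fun l => ?_⟩
    rw [val Q l c hc, congrFun hd l]
    simp [mul_assoc]

/-! ### Differentiable curves and ramification -/

theorem differentiable_eval {σ : Type*} [Fintype σ] (F : MvPolynomial σ ℂ) :
    Differentiable ℂ (fun v : σ → ℂ => MvPolynomial.eval v F) :=
  fun v => (AnalyticOnNhd.eval_mvPolynomial F v (Set.mem_univ v)).differentiableAt

variable {c : ℂ → S} {t₀ : ℂ}

theorem differentiableAt_value (hc : DifferentiableAt ℂ (fun t => ProjectiveModel.coord (c t)) t₀)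
    (F : MvPolynomial (Fin (ProjectiveModel.dim S + 1)) ℂ) :
    DifferentiableAt ℂ (fun t => value F (c t)) t₀ :=
  (differentiable_eval F _).comp t₀ hc

theorem differentiableAt_of_isRegularAt
    (hc : DifferentiableAt ℂ (fun t => ProjectiveModel.coord (c t)) t₀) {h : S → ℂ}
    (hh : IsRegularAt (c t₀) h) : DifferentiableAt ℂ (fun t => h (c t)) t₀ := by
  obtain ⟨n, F, G, -, -, hG, hFG⟩ := hh
  refine ((differentiableAt_value hc F).div (differentiableAt_value hc G) hG).congr_of_eventuallyEq
    ?_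
  filter_upwards [(differentiableAt_value hc G).continuousAt.eventually_ne hG] with t ht
  exact hFG _ ht

/-- A function in the square of the maximal ideal has derivative zero along every curve through the
point. -/
theorem hasDerivAt_zero_of_mem_sq
    (hc : DifferentiableAt ℂ (fun t => ProjectiveModel.coord (c t)) t₀) {h : localRing (c t₀)}
    (hh : h ∈ vanishingIdeal (c t₀) ^ 2) : HasDerivAt (fun t => (h : S → ℂ) (c t)) 0 t₀ := by
  rw [pow_two] at hh
  refine Submodule.mul_induction_on hh (fun a ha b hb => ?_) fun a b ha hb => ?_
  · have da := (differentiableAt_of_isRegularAt hc a.2).hasDerivAt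
    have db := (differentiableAt_of_isRegularAt hc b.2).hasDerivAt
    have ha0 : (a : S → ℂ) (c t₀) = 0 := ha
    have hb0 : (b : S → ℂ) (c t₀) = 0 := hb
    simpa [ha0, hb0] using! da.mul db
  · simpa using! ha.add hb

/-- At a critical point the function `β`, read in the standard local parameter at its value, has
derivative zero along every curve through the point. -/
theorem IsCriticalPoint.hasDerivAt_zero {β : S → OnePoint ℂ} (h : IsCriticalPoint β (c t₀))
    (hc : DifferentiableAt ℂ (fun t => ProjectiveModel.coord (c t)) t₀) :
    HasDerivAt (fun t => localParameter (β (c t₀)) (β (c t))) 0 t₀ := by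
  obtain ⟨⟨e, f, hf, hfβ⟩, he⟩ : ∃ e : {e : ℕ // ∃ h ∈ vanishingIdeal (c t₀) ^ e,
      (h : S → ℂ) = fun Q => localParameter (β (c t₀)) (β Q)}, 2 ≤ e.1 := by
    by_contra! hlt
    have : ramificationIndex β (c t₀) ≤ 1 :=
      iSup_le fun e => by exact_mod_cast Nat.le_of_lt_succ (hlt e)
    exact absurd (le_trans h this) (by decide)
  have := hasDerivAt_zero_of_mem_sq hc (Ideal.pow_le_pow_right he hf)
  rwa [hfβ] at this

end General

/-! ### Curves in the affine part of an elliptic curve -/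

section Curves

open Filter Topology WeierstrassCurve.Affine ProjectiveModel

variable {S : Type} [ProjectiveModel S] {E X : WeierstrassCurve ℂ}

theorem pointCoord_two_of_ne_zero {P : E.toAffine.Point} (hP : P ≠ 0) : pointCoord E P 2 = 1 := by
  cases P with
  | zero => exact absurd rfl hP
  | some x y h => simp [pointCoord]

theorem pointCoord_two_ne_zero_iff {P : E.toAffine.Point} : pointCoord E P 2 ≠ 0 ↔ P ≠ 0 := by
  refine ⟨?_, fun h => by simp [pointCoord_two_of_ne_zero h]⟩
  rintro h rfl
  exact h (by simp [pointCoord])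

theorem eventually_ne_zero {c : ℂ → E.toAffine.Point} {t₀ : ℂ}
    (hc : DifferentiableAt ℂ (fun t => pointCoord E (c t)) t₀) (h0 : c t₀ ≠ 0) :
    ∀ᶠ t in 𝓝 t₀, c t ≠ 0 := by
  filter_upwards [(differentiableAt_pi.mp hc 2).continuousAt.eventually_ne
    (pointCoord_two_ne_zero_iff.mpr h0)] with t ht
  exact pointCoord_two_ne_zero_iff.mp ht

/-- Dehomogenized by the third coordinate, a regular map to an elliptic curve carries differentiable
curves to differentiable curves as long as the image stays affine. -/
theorem IsRegularMap.differentiableAt {f : S → X.toAffine.Point} (hf : IsRegularMap f)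
    {c : ℂ → S} {t₀ : ℂ} (hc : DifferentiableAt ℂ (fun t => coord (c t)) t₀)
    (h0 : f (c t₀) ≠ 0) : DifferentiableAt ℂ (fun t => pointCoord X (f (c t))) t₀ := by
  obtain ⟨n, F, -, hP, hF⟩ := hf (c t₀)
  have h2 : value (F 2) (c t₀) ≠ 0 := by
    obtain ⟨k, hk⟩ := hP
    obtain ⟨d, hd⟩ := hF _ ⟨k, hk⟩
    have e2 : value (F 2) (c t₀) = d * pointCoord X (f (c t₀)) 2 := congrFun hd 2
    rw [e2, pointCoord_two_of_ne_zero h0, mul_one]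
    rintro rfl
    exact hk (by simpa using congrFun hd k)
  have hG : DifferentiableAt ℂ
      (fun t => fun k : Fin 3 => value (F k) (c t) / value (F 2) (c t)) t₀ :=
    differentiableAt_pi.mpr fun k =>
      (differentiableAt_value hc (F k)).div (differentiableAt_value hc (F 2)) h2
  refine hG.congr_of_eventuallyEq ?_
  filter_upwards [(differentiableAt_value hc (F 2)).continuousAt.eventually_ne h2] with t ht
  obtain ⟨d, hd⟩ := hF _ ⟨2, ht⟩
  have e2 : value (F 2) (c t) = d * pointCoord X (f (c t)) 2 := congrFun hd 2
  have hne : f (c t) ≠ 0 := pointCoord_two_ne_zero_iff.mp (right_ne_zero_of_mul (e2 ▸ ht))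
  rw [pointCoord_two_of_ne_zero hne, mul_one] at e2
  funext k
  have ek : value (F k) (c t) = d * pointCoord X (f (c t)) k := congrFun hd k
  rw [ek, e2, mul_div_cancel_left₀ _ (e2 ▸ ht)]

/-! ### Translations -/

/-- The secant slope through `(x, y)` and `(x₂, y₂)`, rewritten with the equation of the curve so
that it stays differentiable where the two points coincide. -/
theorem slope_eq_div_sub_negY {x y x₂ y₂ : ℂ} (h : E.toAffine.Equation x y)
    (h₂ : E.toAffine.Equation x₂ y₂) (hy : y ≠ E.toAffine.negY x₂ y₂) :
    E.toAffine.slope x x₂ y y₂ =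
      (x ^ 2 + x * x₂ + x₂ ^ 2 + E.a₂ * (x + x₂) + E.a₄ - E.a₁ * y) /
        (y - E.toAffine.negY x₂ y₂) := by
  have hne := sub_ne_zero.mpr hy
  by_cases hx : x = x₂
  · obtain rfl : y = y₂ := Y_eq_of_Y_ne h h₂ hx hy
    subst hx
    rw [slope_of_Y_ne rfl hy]
    congr 1
    ring
  · rw [slope_of_X_ne hx, div_eq_div_iff (sub_ne_zero.mpr hx) hne, negY]
    rw [equation_iff] at h h₂
    linear_combination h - h₂

theorem exists_differentiableAt_slope {x₀ y₀ x₂ y₂ : ℂ}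
    (h₂ : E.toAffine.Equation x₂ y₂) (hne : ¬(x₀ = x₂ ∧ y₀ = E.toAffine.negY x₂ y₂)) :
    ∃ s : (Fin 3 → ℂ) → ℂ, DifferentiableAt ℂ s ![x₀, y₀, 1] ∧
      ∀ᶠ p in 𝓝 ![x₀, y₀, 1], E.toAffine.Equation (p 0) (p 1) →
        ¬(p 0 = x₂ ∧ p 1 = E.toAffine.negY x₂ y₂) ∧
          E.toAffine.slope (p 0) x₂ (p 1) y₂ = s p := by
  have d : ∀ i : Fin 3, DifferentiableAt ℂ (fun p : Fin 3 → ℂ => p i) ![x₀, y₀, 1] :=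
    fun i => differentiableAt_apply i _
  have d0 := d 0
  have d1 := d 1
  by_cases hx : x₀ = x₂
  · have hy : y₀ ≠ E.toAffine.negY x₂ y₂ := fun h => hne ⟨hx, h⟩
    refine ⟨fun p => (p 0 ^ 2 + p 0 * x₂ + x₂ ^ 2 + E.a₂ * (p 0 + x₂) + E.a₄ - E.a₁ * p 1) /
        (p 1 - E.toAffine.negY x₂ y₂), ?_, ?_⟩
    · simp only [div_eq_mul_inv]
      refine DifferentiableAt.fun_mul (by fun_prop) (DifferentiableAt.fun_inv (by fun_prop) ?_)
      simpa using sub_ne_zero.mpr hy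
    · filter_upwards [d1.continuousAt.eventually_ne (by simpa using hy)] with p hp hE
      exact ⟨fun h => hp h.2, slope_eq_div_sub_negY hE h₂ hp⟩
  · refine ⟨fun p => (p 1 - y₂) / (p 0 - x₂), ?_, ?_⟩
    · simp only [div_eq_mul_inv]
      refine DifferentiableAt.fun_mul (by fun_prop) (DifferentiableAt.fun_inv (by fun_prop) ?_)
      simpa using sub_ne_zero.mpr hx
    · filter_upwards [d0.continuousAt.eventually_ne (by simpa using hx)] with p hp hE
      exact ⟨fun h => hp h.1, slope_of_X_ne hp⟩

/-- Translation by `T` is differentiable at every affine point that it carries to an affine point: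
`A` is its tangent map in affine coordinates. -/
theorem exists_tangentMap_add {R T : E.toAffine.Point} (hR : R ≠ 0) (hRT : R + T ≠ 0) :
    ∃ A : (Fin 3 → ℂ) →L[ℂ] (Fin 3 → ℂ), ∀ (c : ℂ → E.toAffine.Point) (t₀ : ℂ) (d : Fin 3 → ℂ),
      c t₀ = R → HasDerivAt (fun t => pointCoord E (c t)) d t₀ →
        HasDerivAt (fun t => pointCoord E (c t + T)) (A d) t₀ := by
  cases T with
  | zero => exact ⟨.id ℂ _, fun c t₀ d _ hd => by simpa [← Point.zero_def] using hd⟩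
  | some x₂ y₂ h₂ =>
  cases R with
  | zero => exact absurd rfl hR
  | some x₀ y₀ h₀ =>
  have hne : ¬(x₀ = x₂ ∧ y₀ = E.toAffine.negY x₂ y₂) :=
    fun h => hRT (Point.add_of_Y_eq h.1 h.2)
  obtain ⟨s, hs, hs'⟩ := exists_differentiableAt_slope h₂.1 hne
  let Φ : (Fin 3 → ℂ) → Fin 3 → ℂ := fun p =>
    ![E.toAffine.addX (p 0) x₂ (s p), E.toAffine.addY (p 0) x₂ (p 1) (s p), 1]
  have hΦ : DifferentiableAt ℂ Φ ![x₀, y₀, 1] := by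
    refine differentiableAt_pi.mpr fun i => ?_
    fin_cases i
    · simp only [Φ, addX]
      simp
      fun_prop
    · simp only [Φ, addX, addY, negAddY, negY]
      simp
      fun_prop
    · simp [Φ]
  refine ⟨fderiv ℂ Φ ![x₀, y₀, 1], fun c t₀ d hc hd => ?_⟩
  have e0 : pointCoord E (c t₀) = ![x₀, y₀, 1] := by rw [hc]; rfl
  have hcomp := (e0 ▸ hΦ.hasFDerivAt :
    HasFDerivAt Φ (fderiv ℂ Φ ![x₀, y₀, 1]) (pointCoord E (c t₀))).comp_hasDerivAt t₀ hd
  refine hcomp.congr_of_eventuallyEq ?_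
  have htend : Tendsto (fun t => pointCoord E (c t)) (𝓝 t₀) (𝓝 ![x₀, y₀, 1]) :=
    e0 ▸ hd.continuousAt
  filter_upwards [htend.eventually hs', eventually_ne_zero hd.differentiableAt (hc ▸ hR)]
    with t ht htne
  simp only [Function.comp_apply]
  generalize c t = Q at ht htne
  cases Q with
  | zero => exact absurd rfl htne
  | some x y h =>
    obtain ⟨h1, h2⟩ := ht h.1
    change ¬(x = x₂ ∧ y = E.toAffine.negY x₂ y₂) at h1
    change E.toAffine.slope x x₂ y y₂ = s ![x, y, 1] at h2
    rw [Point.add_some h1]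
    simp [Φ, pointCoord, h2]

/-! ### A local parametrization -/

/-- Near a suitable abscissa the curve is parametrized by `x`: the quadratic equation for `y` is
solved by the principal square root of its discriminant. -/
theorem exists_parametrization (E : WeierstrassCurve ℂ) [E.IsElliptic] :
    ∃ (U : Set ℂ) (c : ℂ → E.toAffine.Point), IsOpen U ∧ U.Nonempty ∧ ∀ t ∈ U,
      c t ≠ 0 ∧ pointCoord E (c t) 0 = t ∧
        DifferentiableAt ℂ (fun t => pointCoord E (c t)) t := by
  let D : ℂ → ℂ := fun t => (E.a₁ * t + E.a₃) ^ 2 +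
    4 * (t ^ 3 + E.a₂ * t ^ 2 + E.a₄ * t + E.a₆)
  have hD : Differentiable ℂ D := by fun_prop
  let y : ℂ → ℂ := fun t => (-(E.a₁ * t + E.a₃) + D t ^ (1 / 2 : ℂ)) / 2
  have hy : ∀ t, E.toAffine.Equation t (y t) := by
    intro t
    have hsq : (D t ^ (1 / 2 : ℂ)) ^ 2 = D t := by
      rw [← Complex.cpow_nat_mul]
      simp
    rw [equation_iff]
    have : D t = (E.a₁ * t + E.a₃) ^ 2 + 4 * (t ^ 3 + E.a₂ * t ^ 2 + E.a₄ * t + E.a₆) := rfl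
    simp only [y]
    linear_combination (1 / 4 : ℂ) * hsq + (1 / 4 : ℂ) * this
  -- the discriminant takes the value `1`, which lies in the domain of the square root
  obtain ⟨t₁, ht₁⟩ : ∃ t, D t = 1 := by
    have hdeg : (Cubic.toPoly ⟨4, E.a₁ ^ 2 + 4 * E.a₂, 2 * E.a₁ * E.a₃ + 4 * E.a₄,
        E.a₃ ^ 2 + 4 * E.a₆ - 1⟩ : Polynomial ℂ).degree = 3 :=
      Cubic.degree_of_a_ne_zero (by norm_num)
    obtain ⟨t, ht⟩ := IsAlgClosed.exists_root _ (by rw [hdeg]; decide)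
    refine ⟨t, ?_⟩
    simp [Cubic.toPoly] at ht
    simp only [D]
    linear_combination ht
  refine ⟨D ⁻¹' Complex.slitPlane, fun t => .some t (y t) (equation_iff_nonsingular.mp (hy t)),
    Complex.isOpen_slitPlane.preimage hD.continuous, ⟨t₁, by simp [ht₁]⟩, fun t ht => ?_⟩
  refine ⟨Point.some_ne_zero _, rfl, differentiableAt_pi.mpr fun i => ?_⟩
  have hyd : DifferentiableAt ℂ y t := by
    have := (hD t).cpow (differentiableAt_const (1 / 2 : ℂ)) ht
    simp only [y]
    fun_prop
  fin_cases i
  · exact differentiableAt_id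
  · exact hyd
  · exact differentiableAt_const _

end Curves

/-! ### Isogenies with infinite kernel -/

section Isogeny

open Filter Topology WeierstrassCurve.Affine ProjectiveModel

variable {E X : WeierstrassCurve ℂ}

/-- Reduced modulo the equation, the polynomial is `p(x) + q(x) y`; its norm to `ℂ[x]` vanishes at
the abscissas of the common zeros, hence identically, and the coordinate ring is a domain. -/
theorem mk_eq_zero_of_infinite (f : Polynomial (Polynomial ℂ))
    (hf : {P : ℂ × ℂ | E.toAffine.Equation P.1 P.2 ∧ f.evalEval P.1 P.2 = 0}.Infinite) :
    CoordinateRing.mk E.toAffine f = 0 := by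
  classical
  obtain ⟨p, q, hpq⟩ := CoordinateRing.exists_smul_basis_eq (CoordinateRing.mk E.toAffine f)
  set N := Algebra.norm (Polynomial ℂ) (CoordinateRing.mk E.toAffine f) with hN
  have hNf := CoordinateRing.norm_smul_basis (W' := E.toAffine) p q
  rw [hpq, ← hN] at hNf
  have hval : ∀ x y, E.toAffine.Equation x y → f.evalEval x y = 0 → N.eval x = 0 := by
    intro x y hxy hfy
    have h1 : p.eval x + q.eval x * y = 0 := by
      have hmk : CoordinateRing.mk E.toAffine f =
          CoordinateRing.mk E.toAffine (Polynomial.C p + Polynomial.C q * Polynomial.X) := by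
        rw [← hpq, CoordinateRing.smul, CoordinateRing.smul, mul_one, map_add, map_mul]
      obtain ⟨g, hg⟩ := AdjoinRoot.mk_eq_mk.mp hmk
      have := congrArg (Polynomial.evalEval x y) hg
      simp only [Polynomial.evalEval_sub, Polynomial.evalEval_add, Polynomial.evalEval_mul,
        Polynomial.evalEval_C, Polynomial.evalEval_X, hfy, (show _ = _ from hxy)] at this
      linear_combination -this
    rw [equation_iff] at hxy
    rw [hNf]
    simp
    linear_combination (p.eval x - q.eval x * y - q.eval x * (E.a₁ * x + E.a₃)) * h1 +
      (q.eval x) ^ 2 * hxy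
  have hN0 : N = 0 := by
    by_contra hN0
    refine hf (Set.Finite.subset (s := ⋃ x ∈ N.roots.toFinset, (fun y => (x, y)) ''
      {y | E.toAffine.Equation x y}) ?_ ?_)
    · refine Set.Finite.biUnion (Finset.finite_toSet _) fun x _ => Set.Finite.image _ ?_
      by_cases h : ∃ y₀, E.toAffine.Equation x y₀
      · obtain ⟨y₀, h₀⟩ := h
        exact (Set.toFinite {y₀, E.toAffine.negY x y₀}).subset fun y hy => Y_eq_of_X_eq hy h₀ rfl
      · push Not at h
        simp [h]
    · rintro ⟨x, y⟩ ⟨hxy, hfy⟩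
      simp only [Set.mem_iUnion, Set.mem_image]
      exact ⟨x, by simp [hN0, hval x y hxy hfy], y, hxy, rfl⟩
  have : Module.Finite (Polynomial ℂ) E.toAffine.CoordinateRing :=
    .of_basis (CoordinateRing.basis E.toAffine)
  exact Algebra.norm_eq_zero_iff.mp hN0

theorem value_eq_zero_of_infinite (F : MvPolynomial (Fin 3) ℂ)
    (hF : {P : E.toAffine.Point | P ≠ 0 ∧ value (S := E.toAffine.Point) F P = 0}.Infinite)
    {P : E.toAffine.Point} (hP : P ≠ 0) : value (S := E.toAffine.Point) F P = 0 := by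
  let f : Polynomial (Polynomial ℂ) :=
    MvPolynomial.aeval ![Polynomial.C Polynomial.X, Polynomial.X, 1] F
  have hval : ∀ x y (h : E.toAffine.Nonsingular x y),
      value (S := E.toAffine.Point) F (.some x y h) = f.evalEval x y := by
    intro x y h
    have : (Polynomial.evalEvalRingHom x y).comp (MvPolynomial.aeval (R := ℂ)
        (![Polynomial.C Polynomial.X, Polynomial.X, 1] : Fin 3 → Polynomial (Polynomial ℂ))
          ).toRingHom = MvPolynomial.eval ![x, y, 1] := by
      refine MvPolynomial.ringHom_ext (fun a => ?_) fun i => ?_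
      · simp [Polynomial.algebraMap_apply]
      · fin_cases i <;> simp
    exact (RingHom.congr_fun this F).symm
  have hf : CoordinateRing.mk E.toAffine f = 0 := by
    refine mk_eq_zero_of_infinite f fun hfin => hF ?_
    refine Set.Finite.of_injOn (f := fun P => (pointCoord E P 0, pointCoord E P 1))
      (fun P hP => ?_) (fun P hP Q hQ hPQ => ?_) hfin
    · obtain ⟨hP0, hPF⟩ := hP
      cases P with
      | zero => exact absurd rfl hP0
      | some x y h => exact ⟨h.1, hval x y h ▸ hPF⟩
    · have hP0 := hP.1
      have hQ0 := hQ.1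
      cases P with
      | zero => exact absurd rfl hP0
      | some x y h =>
      cases Q with
      | zero => exact absurd rfl hQ0
      | some x' y' h' => simpa [pointCoord] using hPQ
  cases P with
  | zero => exact absurd rfl hP
  | some x y h =>
    rw [hval]
    obtain ⟨g, hg⟩ := AdjoinRoot.mk_eq_zero.mp hf
    rw [hg, Polynomial.evalEval_mul, (show _ = _ from h.1), zero_mul]

theorem IsIsogeny.map_zero {ψ : E.toAffine.Point → X.toAffine.Point} (hψ : IsIsogeny ψ) :
    ψ 0 = 0 := by
  simpa using hψ.2 0 0

theorem IsIsogeny.map_sub {ψ : E.toAffine.Point → X.toAffine.Point} (hψ : IsIsogeny ψ)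
    (P Q : E.toAffine.Point) : ψ (P - Q) = ψ P - ψ Q :=
  _root_.map_sub (AddMonoidHom.mk' ψ hψ.2) P Q

/-- The polynomials that give the isogeny near `P` map infinitely many points to multiples of
`(0, 1, 0)`, hence all of them. -/
theorem IsIsogeny.eq_zero_of_infinite {ψ : E.toAffine.Point → X.toAffine.Point}
    (hψ : IsIsogeny ψ) (hinf : {P | ψ P = 0}.Infinite) (P : E.toAffine.Point) : ψ P = 0 := by
  by_cases hP : P = 0
  · rw [hP, hψ.map_zero]
  obtain ⟨n, F, -, ⟨k, hk⟩, hF⟩ := hψ.1 P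
  obtain ⟨d, hd⟩ := hF P ⟨k, hk⟩
  have h2 : value (F 2) P = 0 := by
    refine value_eq_zero_of_infinite (F 2) ?_ hP
    refine (hinf.sdiff (Set.finite_singleton 0)).mono ?_
    rintro Q ⟨hQ, hQ0⟩
    refine ⟨hQ0, ?_⟩
    by_cases h : ∃ k, value (F k) Q ≠ 0
    · obtain ⟨e, he⟩ := hF Q h
      rw [show ψ Q = 0 from hQ] at he
      have : value (F 2) Q = e * 0 := congrFun he 2
      rw [this, mul_zero]
    · push Not at h
      exact h 2
  by_contra h0
  have e2 : value (F 2) P = d * pointCoord X (ψ P) 2 := congrFun hd 2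
  rw [h2, pointCoord_two_of_ne_zero h0, mul_one] at e2
  exact hk (by simpa [← e2] using congrFun hd k)

/-! ### Isogenies are unramified -/

/-- If the tangent map of `ψ` vanishes at one affine point `P`, then by translation it vanishes
along every curve, `ψ` is constant on a disc and its kernel is infinite. -/
theorem IsIsogeny.eq_zero_of_hasDerivAt_zero [E.IsElliptic]
    {ψ : E.toAffine.Point → X.toAffine.Point} (hψ : IsIsogeny ψ) {P : E.toAffine.Point}
    (hP : P ≠ 0) (hψP : ψ P ≠ 0)
    (hram : ∀ (c : ℂ → E.toAffine.Point) (t₀ : ℂ), c t₀ = P →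
      DifferentiableAt ℂ (fun t => pointCoord E (c t)) t₀ →
        HasDerivAt (fun t => pointCoord X (ψ (c t))) 0 t₀) (Q : E.toAffine.Point) : ψ Q = 0 := by
  obtain ⟨U, c, hU, ⟨t₁, ht₁⟩, hc⟩ := exists_parametrization E
  have hinj : Set.InjOn c U := fun s hs t ht hst => by rw [← (hc s hs).2.1, hst, (hc t ht).2.1]
  -- the curve is translated so that it passes through `P`, and its image is translated back
  have hderiv : ∀ s ∈ U, ψ (c s) ≠ 0 → HasDerivAt (fun t => pointCoord X (ψ (c t))) 0 s := by
    intro s hs hψs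
    obtain ⟨hs0, -, hsd⟩ := hc s hs
    obtain ⟨A, hA⟩ := exists_tangentMap_add (R := c s) (T := -(c s - P)) hs0 (by simpa using hP)
    have h1 := hram (fun t => c t + -(c s - P)) s (by simp)
      (hA c s _ rfl hsd.hasDerivAt).differentiableAt
    obtain ⟨B, hB⟩ := exists_tangentMap_add (R := ψ P) (T := ψ (c s - P)) hψP
      (by simpa [hψ.map_sub] using hψs)
    have h2 := hB (fun t => ψ (c t + -(c s - P))) s 0 (by simp) h1
    have h3 : ∀ t, ψ (c t + -(c s - P)) + ψ (c s - P) = ψ (c t) := fun t => by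
      rw [← hψ.2, neg_add_cancel_right]
    simpa only [h3, _root_.map_zero] using h2
  refine hψ.eq_zero_of_infinite (fun hfin => ?_) Q
  have hinfU : ∀ V : Set ℂ, IsOpen V → V.Nonempty → V ⊆ U → (c '' V).Infinite :=
    fun V hV ⟨v, hv⟩ hVU => (infinite_of_mem_nhds v (hV.mem_nhds hv)).image (hinj.mono hVU)
  obtain ⟨t₂, ht₂, hψ₂⟩ : ∃ t ∈ U, ψ (c t) ≠ 0 := by
    by_contra! h
    exact hinfU U hU ⟨t₁, ht₁⟩ subset_rfl (hfin.subset (by rintro _ ⟨t, ht, rfl⟩; exact h t ht))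
  have hev : ∀ᶠ t in 𝓝 t₂, t ∈ U ∧ ψ (c t) ≠ 0 :=
    Filter.Eventually.and (hU.mem_nhds ht₂) (eventually_ne_zero
      (hψ.1.differentiableAt (hc t₂ ht₂).2.2 hψ₂) hψ₂)
  obtain ⟨r, hr, hball⟩ := Metric.eventually_nhds_iff_ball.mp hev
  have hconst : ∀ t ∈ Metric.ball t₂ r, ψ (c t) = ψ (c t₂) := by
    intro t ht
    have h := Metric.isOpen_ball.is_const_of_deriv_eq_zero
      (convex_ball t₂ r).isPreconnected
      (fun s hs => (hderiv s (hball s hs).1 (hball s hs).2).differentiableAt.differentiableWithinAt)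
      (fun s hs => (hderiv s (hball s hs).1 (hball s hs).2).deriv) ht (Metric.mem_ball_self hr)
    exact (curveModel X).coord_injective _ _ 1 (by simpa using! h)
  refine (hinfU _ Metric.isOpen_ball ⟨t₂, Metric.mem_ball_self hr⟩ fun s hs => (hball s hs).1).image
    (f := fun R => R - c t₂) (sub_left_injective.injOn) (hfin.subset ?_)
  rintro _ ⟨_, ⟨t, ht, rfl⟩, rfl⟩
  simp [hψ.map_sub, hconst t ht]

end Isogeny

/-! ### The function `(1 - y) / 2` on `y² = x³ + 1` -/

section Base

open Filter Topology WeierstrassCurve.Affine ProjectiveModel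

variable {E : WeierstrassCurve ℂ}

theorem curveX_isElliptic : curveX.IsElliptic := by
  constructor
  simp [curveX, WeierstrassCurve.Δ, WeierstrassCurve.b₂, WeierstrassCurve.b₄, WeierstrassCurve.b₆,
    WeierstrassCurve.b₈]

theorem curveX_equation_iff {x y : ℂ} : curveX.toAffine.Equation x y ↔ y ^ 2 = x ^ 3 + 1 := by
  rw [equation_iff]
  simp [curveX]

theorem curveX_nonsingular_iff {x y : ℂ} :
    curveX.toAffine.Nonsingular x y ↔ y ^ 2 = x ^ 3 + 1 := by
  have := curveX_isElliptic
  rw [← curveX_equation_iff, equation_iff_nonsingular]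

theorem phiX_eq_infty_iff {P : curveX.toAffine.Point} : phiX P = ∞ ↔ P = 0 := by
  cases P with
  | zero => simp [phiX, ← Point.zero_def]
  | some x y h => simp [phiX]

theorem isRegularMap_phiX : IsRegularMap phiX := by
  refine .of_forall _ 1 ![MvPolynomial.C (1 / 2) * (MvPolynomial.X 2 - MvPolynomial.X 1),
    MvPolynomial.X 2] (fun k => ?_) (fun P => ?_) fun P => ?_
  · fin_cases k
    · exact ((MvPolynomial.isHomogeneous_X _ _).sub (MvPolynomial.isHomogeneous_X _ _)).C_mul _
    · exact MvPolynomial.isHomogeneous_X _ _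
  · cases P with
    | zero => exact ⟨0, by simp [value, coord, pointCoord]⟩
    | some x y h => exact ⟨1, by simp [value, coord, pointCoord]⟩
  · cases P with
    | zero =>
      refine ⟨-(1 / 2), funext fun k => ?_⟩
      fin_cases k <;> simp [value, coord, pointCoord, phiX, sphereCoord]
    | some x y h =>
      refine ⟨1, funext fun k => ?_⟩
      fin_cases k <;> simp [value, coord, pointCoord, phiX, sphereCoord]
      ring

theorem phiX_some_mem_specialValues_iff {x y : ℂ} (h : curveX.toAffine.Nonsingular x y) :
    phiX (.some x y h) ∈ specialValues ↔ y = 1 ∨ y = -1 := by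
  simp only [phiX, specialValues, Set.mem_insert_iff, Set.mem_singleton_iff,
    OnePoint.coe_ne_infty, or_false, OnePoint.coe_eq_coe]
  refine or_congr ⟨fun e => ?_, fun e => ?_⟩ ⟨fun e => ?_, fun e => ?_⟩
  · linear_combination -2 * e
  · linear_combination (-1 / 2) * e
  · linear_combination -2 * e
  · linear_combination (-1 / 2) * e

theorem y_eq_one_or_neg_one_iff {x y : ℂ} (h : curveX.toAffine.Nonsingular x y) :
    y = 1 ∨ y = -1 ↔ x = 0 := by
  rw [← sq_eq_one_iff, curveX_nonsingular_iff.mp h]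
  simp

theorem mem_quasiCriticalPoints_phiX {P : curveX.toAffine.Point} :
    P ∈ quasiCriticalPoints phiX ↔ P = 0 ∨ ∃ y h, P = .some 0 y h ∧ (y = 1 ∨ y = -1) := by
  cases P with
  | zero => simp [quasiCriticalPoints, phiX, specialValues, ← Point.zero_def]
  | some x y h =>
    rw [quasiCriticalPoints, Set.mem_preimage, phiX_some_mem_specialValues_iff h]
    constructor
    · intro hy
      obtain rfl := (y_eq_one_or_neg_one_iff h).mp hy
      exact .inr ⟨y, h, rfl, hy⟩
    · rintro (h0 | ⟨y', h', e, hy⟩)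
      · exact absurd h0 (Point.some_ne_zero h)
      · simp only [Point.some.injEq] at e
        rwa [e.2]

/-- The point `(0, 1)`. -/
def threeTorsionPoint : curveX.toAffine.Point :=
  .some 0 1 (curveX_nonsingular_iff.mpr (by norm_num))

theorem neg_threeTorsionPoint :
    -threeTorsionPoint = .some 0 (-1) (curveX_nonsingular_iff.mpr (by norm_num)) := by
  rw [threeTorsionPoint, Point.neg_some]
  simp [negY, curveX]

theorem threeTorsionPoint_add_self :
    threeTorsionPoint + threeTorsionPoint = -threeTorsionPoint := by
  have h1 : (1 : ℂ) ≠ curveX.toAffine.negY 0 1 := by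
    simp [negY, curveX]
    norm_num
  rw [neg_threeTorsionPoint, threeTorsionPoint, Point.add_self_of_Y_ne h1]
  simp [addX, addY, negAddY, negY, slope_of_Y_ne rfl h1]
  simp [curveX]

theorem addOrderOf_threeTorsionPoint : addOrderOf threeTorsionPoint = 3 := by
  have : Fact (Nat.Prime 3) := ⟨Nat.prime_three⟩
  refine addOrderOf_eq_prime ?_ (Point.some_ne_zero _)
  rw [succ_nsmul, two_nsmul, threeTorsionPoint_add_self, neg_add_cancel]

theorem coe_zmultiples_threeTorsionPoint :
    (AddSubgroup.zmultiples threeTorsionPoint : Set curveX.toAffine.Point) =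
      quasiCriticalPoints phiX := by
  ext P
  rw [mem_quasiCriticalPoints_phiX, SetLike.mem_coe]
  constructor
  · intro hP
    have h3 : (3 : ℤ) • threeTorsionPoint = 0 := by
      rw [← addOrderOf_dvd_iff_zsmul_eq_zero, addOrderOf_threeTorsionPoint]
      rfl
    obtain ⟨k, rfl⟩ := AddSubgroup.mem_zmultiples_iff.mp hP
    rw [← Int.emod_add_mul_ediv k 3, add_zsmul, mul_comm, mul_zsmul, h3, zsmul_zero, add_zero]
    have : k % 3 = 0 ∨ k % 3 = 1 ∨ k % 3 = 2 := by omega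
    rcases this with h | h | h <;> rw [h]
    · exact .inl (zero_zsmul _)
    · exact .inr ⟨1, _, one_zsmul _, .inl rfl⟩
    · refine .inr ⟨-1, curveX_nonsingular_iff.mpr (by norm_num), ?_, .inr rfl⟩
      rw [two_zsmul, threeTorsionPoint_add_self, neg_threeTorsionPoint]
  · rintro (rfl | ⟨y, h, rfl, rfl | rfl⟩)
    · exact zero_mem _
    · exact AddSubgroup.mem_zmultiples threeTorsionPoint
    · rw [← neg_threeTorsionPoint]
      exact neg_mem (AddSubgroup.mem_zmultiples threeTorsionPoint)

theorem nonempty_zmultiples_threeTorsionPoint_equiv :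
    Nonempty (AddSubgroup.zmultiples threeTorsionPoint ≃+ ZMod 3) := by
  have h := Nat.card_zmultiples threeTorsionPoint
  rw [addOrderOf_threeTorsionPoint] at h
  exact ⟨(h ▸ zmodAddCyclicAddEquiv (G := AddSubgroup.zmultiples threeTorsionPoint)
    inferInstance).symm⟩

/-! ### Composition with isogenies -/

/-- At a critical point of `φ ∘ ψ` with `φ (ψ P) ∉ {0, 1, ∞}` the derivative of `y ∘ ψ` vanishes
along every curve, and so does that of `x ∘ ψ`, because `3 x² dx = 2 y dy` and `x (ψ P) ≠ 0`. -/
theorem hasDerivAt_zero_of_isCriticalPoint {ψ : E.toAffine.Point → curveX.toAffine.Point}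
    (hψ : IsRegularMap ψ) {c : ℂ → E.toAffine.Point} {t₀ : ℂ}
    (hcrit : IsCriticalPoint (phiX ∘ ψ) (c t₀)) (hsp : phiX (ψ (c t₀)) ∉ specialValues)
    (hc : DifferentiableAt ℂ (fun t => pointCoord E (c t)) t₀) :
    HasDerivAt (fun t => pointCoord curveX (ψ (c t))) 0 t₀ := by
  have h0 : ψ (c t₀) ≠ 0 := fun h => hsp (by simp [h, phiX_eq_infty_iff.mpr, specialValues])
  have hd := (hψ.differentiableAt hc h0)
  have hne := eventually_ne_zero hd h0
  have hcoord : ∀ P : curveX.toAffine.Point, P ≠ 0 → phiX P =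
      (((1 - pointCoord curveX P 1) / 2 : ℂ) : OnePoint ℂ) ∧
        pointCoord curveX P 1 ^ 2 = pointCoord curveX P 0 ^ 3 + 1 := by
    intro P hP
    cases P with
    | zero => exact absurd rfl hP
    | some x y h => exact ⟨rfl, curveX_nonsingular_iff.mp h⟩
  have hx0 : pointCoord curveX (ψ (c t₀)) 0 ≠ 0 := by
    generalize ψ (c t₀) = P at hsp h0
    cases P with
    | zero => exact absurd rfl h0
    | some x y h =>
      rw [phiX_some_mem_specialValues_iff, y_eq_one_or_neg_one_iff h] at hsp
      exact hsp
  have hy : HasDerivAt (fun t => pointCoord curveX (ψ (c t)) 1) 0 t₀ := by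
    have h1 := ((hcrit.hasDerivAt_zero hc).const_mul (-2)).const_add
      (pointCoord curveX (ψ (c t₀)) 1)
    rw [mul_zero] at h1
    refine h1.congr_of_eventuallyEq ?_
    filter_upwards [hne] with t ht
    simp only [Function.comp_apply, (hcoord _ ht).1, (hcoord _ h0).1, localParameter]
    ring
  have hx := (differentiableAt_pi.mp hd 0).hasDerivAt
  have hx' : deriv (fun t => pointCoord curveX (ψ (c t)) 0) t₀ = 0 := by
    have h1 : HasDerivAt (fun t => pointCoord curveX (ψ (c t)) 0 ^ 3 + 1) 0 t₀ := by
      have h2 := hy.fun_pow 2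
      simp only [mul_zero] at h2
      refine h2.congr_of_eventuallyEq ?_
      filter_upwards [hne] with t ht
      exact (hcoord _ ht).2.symm
    have h2 := ((hx.fun_pow 3).add_const 1).unique h1
    simpa [hx0] using h2
  rw [hx'] at hx
  refine hasDerivAt_pi.mpr fun i => ?_
  fin_cases i
  · exact hx
  · exact hy
  · refine (hasDerivAt_const t₀ (1 : ℂ)).congr_of_eventuallyEq ?_
    filter_upwards [hne] with t ht
    exact pointCoord_two_of_ne_zero ht

theorem isMeromorphic_phiX : IsMeromorphic phiX :=
  ⟨isRegularMap_phiX, threeTorsionPoint, by simp [phiX_eq_infty_iff, threeTorsionPoint]⟩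

/-- Composing `φ` with a non-constant isogeny creates no new critical values, because a critical
point outside the quasi-critical ones would force the isogeny to be zero. -/
theorem IsIsogeny.isBelyiMap_phiX_comp [E.IsElliptic]
    {ψ : E.toAffine.Point → curveX.toAffine.Point} (hψ : IsIsogeny ψ) (hne : ¬ IsConstant ψ) :
    IsBelyiMap (phiX ∘ ψ) := by
  have hnz : ∃ P, ψ P ≠ 0 := by
    by_contra! h
    exact hne ⟨0, h⟩
  obtain ⟨P, hP⟩ := hnz
  have hP' : phiX (ψ P) ≠ ∞ := mt phiX_eq_infty_iff.mp hP
  refine ⟨⟨isRegularMap_phiX.comp hψ.1, P, hP'⟩, ?_, fun Q hQ => ?_⟩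
  · rintro ⟨b, hb⟩
    refine hP' ((hb P).trans ((hb 0).symm.trans ?_))
    simp [hψ.map_zero, phiX_eq_infty_iff]
  · by_contra hsp
    have h0 : ψ Q ≠ 0 := fun h => hsp (by simp [h, phiX_eq_infty_iff.mpr, specialValues])
    refine hP (hψ.eq_zero_of_hasDerivAt_zero (P := Q) ?_ h0 ?_ P)
    · rintro rfl
      exact h0 hψ.map_zero
    · rintro c t₀ rfl hc
      exact hasDerivAt_zero_of_isCriticalPoint hψ.1 hQ hsp hc

theorem IsIsogeny.quasiCriticalPointsFormGroup {ψ : E.toAffine.Point → curveX.toAffine.Point}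
    (hψ : IsIsogeny ψ) (hE : E.IsElliptic) (hβ : IsBelyiMap (phiX ∘ ψ)) :
    (ToroidalBelyiPair.mk E hE (phiX ∘ ψ) hβ).QuasiCriticalPointsFormGroup :=
  ⟨(AddSubgroup.zmultiples threeTorsionPoint).comap (AddMonoidHom.mk' ψ hψ.2), by
    rw [AddSubgroup.coe_comap, coe_zmultiples_threeTorsionPoint]
    rfl⟩

theorem isDynamicalBelyiMap_id : IsDynamicalBelyiMap id := by
  refine ⟨⟨⟨isRegularMap_id, ((0 : ℂ) : OnePoint ℂ), OnePoint.coe_ne_infty _⟩, ?_, fun P hP => ?_⟩,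
    Set.mapsTo_id _⟩
  · rintro ⟨b, hb⟩
    exact OnePoint.coe_ne_infty (0 : ℂ) ((hb _).trans (hb ∞).symm)
  · induction P with
    | infty => simp [specialValues]
    | coe z =>
      exfalso
      have hc : DifferentiableAt ℂ (fun t : ℂ => coord (t : OnePoint ℂ)) z := by
        refine differentiableAt_pi.mpr fun i => ?_
        fin_cases i
        · exact differentiableAt_id
        · exact differentiableAt_const _
      have h1 := IsCriticalPoint.hasDerivAt_zero (c := fun t : ℂ => (t : OnePoint ℂ)) hP hc
      have h2 : HasDerivAt (fun t : ℂ => t - z) 1 z := (hasDerivAt_id z).sub_const z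
      exact zero_ne_one (h1.unique h2)

theorem IsIsogeny.isImprimitive {ψ : E.toAffine.Point → curveX.toAffine.Point}
    (hψ : IsIsogeny ψ) (hE : E.IsElliptic) (hβ : IsBelyiMap (phiX ∘ ψ)) (hiso : ¬ IsIsomorphism ψ) :
    (ToroidalBelyiPair.mk E hE (phiX ∘ ψ) hβ).IsImprimitive :=
  ⟨curveX, ψ, phiX, id, curveX_isElliptic, hψ, isMeromorphic_phiX, isDynamicalBelyiMap_id, rfl,
    fun h => hiso h.1⟩

end Base

/-! ### Multiplication by powers of two on `y² = x³ + 1` -/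

section Doubling

open WeierstrassCurve.Affine ProjectiveModel

/-- The duplication formula, with `x³` eliminated in favour of `y² - 1`. -/
theorem curveX_add_self_of_ne {x y : ℂ} (h : curveX.toAffine.Nonsingular x y) (hy : y ≠ 0) :
    ∃ h', Point.some x y h + Point.some x y h =
      (.some (x * (y ^ 2 - 9) / (4 * y ^ 2)) ((y ^ 4 + 18 * y ^ 2 - 27) / (8 * y ^ 3)) h' :
        curveX.toAffine.Point) := by
  have hxy := curveX_nonsingular_iff.mp h
  have hne : y ≠ curveX.toAffine.negY x y := by
    simpa [negY, curveX, self_eq_neg] using hy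
  have hs : curveX.toAffine.slope x x y y = 3 * x ^ 2 / (2 * y) := by
    rw [slope_of_Y_ne rfl hne]
    simp [negY, curveX]
    ring
  have hX : curveX.toAffine.addX x x (3 * x ^ 2 / (2 * y)) =
      x * (y ^ 2 - 9) / (4 * y ^ 2) := by
    simp only [addX, curveX]
    field_simp
    linear_combination -36 * x * hxy
  have hY : curveX.toAffine.addY x x y (3 * x ^ 2 / (2 * y)) =
      (y ^ 4 + 18 * y ^ 2 - 27) / (8 * y ^ 3) := by
    rw [addY, negAddY, hX]
    simp only [negY, curveX]
    field_simp
    linear_combination (-72 * y ^ 2 - 216) * hxy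
  have hns := nonsingular_add h h (fun e => hne e.2)
  rw [hs, hX, hY] at hns
  refine ⟨hns, ?_⟩
  rw [Point.add_self_of_Y_ne hne]
  simp only [Point.some.injEq]
  rw [hs]
  exact ⟨hX, hY⟩

theorem curveX_add_self_of_eq {x : ℂ} (h : curveX.toAffine.Nonsingular x 0) :
    Point.some x 0 h + Point.some x 0 h = 0 :=
  Point.add_self_of_Y_eq (by simp [negY, curveX])

/-- Doubling on `y² = x³ + 1`. -/
def double (P : curveX.toAffine.Point) : curveX.toAffine.Point := P + P

/-- Doubling is given on the whole curve by the quartic forms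
`[2xy(y² - 9z²) : y⁴ + 18y²z² - 27z⁴ : 8y³z]`. -/
theorem isRegularMap_double : IsRegularMap double := by
  have hX : ∀ (i : Fin 3) (n : ℕ),
      (MvPolynomial.X i ^ n : MvPolynomial (Fin 3) ℂ).IsHomogeneous n :=
    fun i n => MvPolynomial.isHomogeneous_X_pow i n
  have hX1 : ∀ i : Fin 3, (MvPolynomial.X i : MvPolynomial (Fin 3) ℂ).IsHomogeneous 1 :=
    fun i => MvPolynomial.isHomogeneous_X _ i
  refine .of_forall _ 4 ![
    MvPolynomial.C 2 * (MvPolynomial.X 0 * MvPolynomial.X 1 *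
      (MvPolynomial.X 1 ^ 2 - MvPolynomial.C 9 * MvPolynomial.X 2 ^ 2)),
    MvPolynomial.X 1 ^ 4 + MvPolynomial.C 18 * (MvPolynomial.X 1 ^ 2 * MvPolynomial.X 2 ^ 2) -
      MvPolynomial.C 27 * MvPolynomial.X 2 ^ 4,
    MvPolynomial.C 8 * (MvPolynomial.X 1 ^ 3 * MvPolynomial.X 2)] (fun k => ?_) (fun P => ?_)
    fun P => ?_
  · fin_cases k
    · exact (((hX1 0).mul (hX1 1)).mul ((hX 1 2).sub ((hX 2 2).C_mul 9))).C_mul 2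
    · exact ((hX 1 4).add (((hX 1 2).mul (hX 2 2)).C_mul 18)).sub ((hX 2 4).C_mul 27)
    · exact ((hX 1 3).mul (hX1 2)).C_mul 8
  · cases P with
    | zero => exact ⟨1, by simp [value, coord, pointCoord]⟩
    | some x y h =>
      by_cases hy : y = 0
      · exact ⟨1, by simp [value, coord, pointCoord, hy]⟩
      · exact ⟨2, by simp [value, coord, pointCoord, hy]⟩
  · cases P with
    | zero =>
      refine ⟨1, funext fun k => ?_⟩
      have : double .zero = 0 := add_zero _
      rw [this]
      fin_cases k <;> simp [value, coord, pointCoord]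
    | some x y h =>
      by_cases hy : y = 0
      · subst hy
        refine ⟨-27, funext fun k => ?_⟩
        rw [double, curveX_add_self_of_eq]
        fin_cases k <;> simp [value, coord, pointCoord]
      · obtain ⟨h', e⟩ := curveX_add_self_of_ne h hy
        refine ⟨8 * y ^ 3, funext fun k => ?_⟩
        rw [double, e]
        fin_cases k <;> simp [value, coord, pointCoord] <;> field_simp
        ring

theorem isIsogeny_iterate_double (k : ℕ) : IsIsogeny double^[k] := by
  induction k with
  | zero => exact ⟨isRegularMap_id, fun _ _ => rfl⟩
  | succ k ih =>
    rw [Function.iterate_succ']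
    refine ⟨isRegularMap_double.comp ih.1, fun P Q => ?_⟩
    simp only [Function.comp_apply, double, ih.2]
    abel

/-- For a point with abscissa `x₀`, a root of the quartic `x⁴ - 8x = 4x₀(x³ + 1)` is the abscissa of
a point whose double is the given point up to sign. -/
theorem double_surjective : Function.Surjective double := by
  intro Q
  cases Q with
  | zero => exact ⟨0, add_zero _⟩
  | some x₀ y₀ h₀ =>
    let p : Polynomial ℂ := Polynomial.X ^ 4 - (Polynomial.C (4 * x₀) * Polynomial.X ^ 3 +
      Polynomial.C 8 * Polynomial.X + Polynomial.C (4 * x₀))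
    have hp : p.degree = 4 := by
      simp only [p]
      compute_degree!
    obtain ⟨x, hx⟩ := IsAlgClosed.exists_root p (by rw [hp]; decide)
    obtain ⟨y, hy⟩ := IsAlgClosed.exists_pow_nat_eq (x ^ 3 + 1) (n := 2) (by norm_num)
    have hx' : x ^ 4 - 8 * x = 4 * x₀ * (x ^ 3 + 1) := by
      simp [p] at hx
      linear_combination hx
    have hy0 : y ≠ 0 := by
      rintro rfl
      have h1 : x ^ 3 + 1 = 0 := by linear_combination -hy
      have h2 : x = 0 := by linear_combination (-1 / 9) * hx' + (x / 9 - 4 / 9 * x₀) * h1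
      simp [h2] at h1
    have h := curveX_nonsingular_iff.mpr hy
    obtain ⟨h', e⟩ := curveX_add_self_of_ne h hy0
    have hX : x * (y ^ 2 - 9) / (4 * y ^ 2) = x₀ := by
      rw [div_eq_iff (by simpa using hy0), hy]
      linear_combination hx'
    rcases Point.X_eq_iff (h₁ := h') (h₂ := h₀) |>.mp hX with hQ | hQ
    · exact ⟨_, e.trans hQ⟩
    · refine ⟨-.some x y h, ?_⟩
      rw [double, ← neg_add, e, hQ, neg_neg]

theorem setOf_double_eq_zero_finite : {P | double P = 0}.Finite := by
  by_contra hinf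
  have h0 := (isIsogeny_iterate_double 1).eq_zero_of_infinite hinf
  obtain ⟨P, hP⟩ := double_surjective threeTorsionPoint
  exact Point.some_ne_zero _ (hP.symm.trans (h0 P))

theorem double_fiber_finite (Q : curveX.toAffine.Point) : {P | double P = Q}.Finite := by
  obtain ⟨R, rfl⟩ := double_surjective Q
  refine (setOf_double_eq_zero_finite.image (· + R)).subset fun P hP => ⟨P - R, ?_, by simp⟩
  change P - R + (P - R) = 0
  have hP : P + P = R + R := hP
  rw [sub_add_sub_comm, hP, sub_self]

theorem setOf_iterate_double_eq_zero_finite (k : ℕ) : {P | double^[k] P = 0}.Finite := by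
  induction k with
  | zero => simp
  | succ k ih => exact ih.preimage' fun Q _ => double_fiber_finite Q

theorem exists_ne_zero_double_eq_zero : ∃ P, P ≠ 0 ∧ double P = 0 :=
  ⟨.some (-1) 0 (curveX_nonsingular_iff.mpr (by norm_num)), Point.some_ne_zero _,
    curveX_add_self_of_eq _⟩

theorem iterate_double_zero (k : ℕ) : double^[k] 0 = 0 := (isIsogeny_iterate_double k).map_zero

theorem strictMono_ncard_iterate_double : StrictMono fun k => {P | double^[k] P = 0}.ncard := by
  refine strictMono_nat_of_lt_succ fun k => Set.ncard_lt_ncard ?_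
    (setOf_iterate_double_eq_zero_finite _)
  refine (Set.ssubset_iff_of_subset fun P hP => ?_).mpr ?_
  · change double^[k + 1] P = 0
    rw [Function.iterate_succ_apply', show double^[k] P = 0 from hP]
    exact add_zero _
  · obtain ⟨T, hT, hT2⟩ := exists_ne_zero_double_eq_zero
    obtain ⟨P, rfl⟩ := double_surjective.iterate k T
    exact ⟨P, by simpa [Function.iterate_succ_apply'] using hT2, hT⟩

theorem not_isConstant_iterate_double (k : ℕ) : ¬ IsConstant double^[k] := by
  rintro ⟨b, hb⟩
  obtain ⟨P, hP⟩ := double_surjective.iterate k threeTorsionPoint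
  exact Point.some_ne_zero _
    (hP.symm.trans ((hb P).trans ((hb 0).symm.trans (iterate_double_zero k))))

theorem not_isIsomorphism_iterate_double (k : ℕ) : ¬ IsIsomorphism double^[k + 1] := by
  rintro ⟨-, g, -, hg, -⟩
  obtain ⟨T, hT, hT2⟩ := exists_ne_zero_double_eq_zero
  refine hT (hg.injective ?_)
  rw [Function.iterate_succ_apply, hT2, iterate_double_zero, iterate_double_zero]

/-- The pair formed by `y² = x³ + 1` and the composition of `(1 - y) / 2` with multiplication by
`2 ^ k`. -/
def doublingPair (k : ℕ) : ToroidalBelyiPair :=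
  ⟨curveX, curveX_isElliptic, phiX ∘ double^[k],
    have := curveX_isElliptic
    (isIsogeny_iterate_double k).isBelyiMap_phiX_comp (not_isConstant_iterate_double k)⟩

/-- Isomorphic pairs have equally many poles; those of `doublingPair k` are the points killed by
`2 ^ k`. -/
theorem eq_of_isomorphic_doublingPair {m n : ℕ}
    (h : (doublingPair m).Isomorphic (doublingPair n)) : m = n := by
  obtain ⟨σ, ⟨-, τ, -, hτσ, hστ⟩, hσ⟩ := h
  refine strictMono_ncard_iterate_double.injective ?_
  have hpole : ∀ P : curveX.toAffine.Point, double^[m] P = 0 ↔ double^[n] (σ P) = 0 := fun P => by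
    rw [← phiX_eq_infty_iff, ← phiX_eq_infty_iff]
    exact Eq.congr_left (congrFun hσ P)
  have himage : {P | double^[m] P = 0} = σ ⁻¹' {P | double^[n] P = 0} := Set.ext hpole
  change Set.ncard {P | double^[m] P = 0} = Set.ncard {P | double^[n] P = 0}
  rw [himage]
  exact Set.ncard_preimage_of_injective_subset_range hτσ.injective
    (fun P _ => hστ.surjective P)

end Doubling

end ToroidalBelyi

end

open ToroidalBelyi in
theorem mainTheorem3 :
    -- the starting pair, whose quasi-critical points form a cyclic group of order three
    (curveX.IsElliptic ∧ IsBelyiMap phiX ∧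
      (∀ P, P ∈ quasiCriticalPoints phiX ↔ P = 0 ∨
        ∃ y h, P = WeierstrassCurve.Affine.Point.some 0 y h ∧ (y = 1 ∨ y = -1)) ∧
      ∃ H : AddSubgroup curveX.toAffine.Point,
        (H : Set curveX.toAffine.Point) = quasiCriticalPoints phiX ∧ Nonempty (H ≃+ ZMod 3)) ∧
    -- every non-constant isogeny into this curve gives a pair of the required kind
    (∀ (E : WeierstrassCurve ℂ) (ψ : E.toAffine.Point → curveX.toAffine.Point),
      ∀ hE : E.IsElliptic, IsIsogeny ψ → ¬ IsConstant ψ →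
        ∃ hβ : IsBelyiMap (phiX ∘ ψ),
          (ToroidalBelyiPair.mk E hE (phiX ∘ ψ) hβ).QuasiCriticalPointsFormGroup ∧
          (¬ IsIsomorphism ψ → (ToroidalBelyiPair.mk E hE (phiX ∘ ψ) hβ).IsImprimitive)) ∧
    -- infinitely many of these pairs are imprimitive and pairwise non-isomorphic
    ∃ p : ℕ → ToroidalBelyiPair,
      (∀ m n, m ≠ n → ¬ (p m).Isomorphic (p n)) ∧
      ∀ n, (p n).IsImprimitive ∧ (p n).QuasiCriticalPointsFormGroup ∧
        ∃ ψ : (p n).curve.toAffine.Point → curveX.toAffine.Point,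
          IsIsogeny ψ ∧ ¬ IsConstant ψ ∧ (p n).map = phiX ∘ ψ := by
  refine ⟨⟨curveX_isElliptic, (doublingPair 0).isBelyiMap,
    fun P => mem_quasiCriticalPoints_phiX, _, coe_zmultiples_threeTorsionPoint,
    nonempty_zmultiples_threeTorsionPoint_equiv⟩, fun E ψ hE hψ hne => ?_,
    fun k => doublingPair (k + 1), fun m n hmn h => ?_, fun k => ⟨?_, ?_, ?_⟩⟩
  · exact ⟨hψ.isBelyiMap_phiX_comp hne, hψ.quasiCriticalPointsFormGroup hE _,
      hψ.isImprimitive hE _⟩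
  · exact hmn (Nat.succ_injective (eq_of_isomorphic_doublingPair h))
  · exact (isIsogeny_iterate_double (k + 1)).isImprimitive _ _ (not_isIsomorphism_iterate_double k)
  · exact (isIsogeny_iterate_double (k + 1)).quasiCriticalPointsFormGroup _ _
  · exact ⟨_, isIsogeny_iterate_double (k + 1), not_isConstant_iterate_double (k + 1), rfl⟩
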